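/- Let $K$ be a quadratic number field. For $f\in K[x]$ with a square root $\sqrt f$ in $K((1/x))$, let $\alpha_0=\sqrt f$ and, for $h\ge 0$, let $a_h\in K[x]$ be the polynomial part of $\alpha_h$ and $\alpha_{h+1}=(\alpha_h-a_h)^{-1}$. The continued fraction $\sqrt f=[a_0,a_1,a_2,\dots]$ is said to be periodic with period $n$ if it is infinite and $n$ is the least positive integer such that $a_{h+n}=a_h$ for every $h>1$. Let $f(x)=(x^2+u)^2-4v(x+w)$, where $u,v,w\in K$ are given by one of the following. (i) For some $t\in K$ with $t(t-1)(2t-1)\neq 0$, $$u=-4-\frac1{4t^2}+\frac2t+t+t^2,\qquad v=(t-1)(2t-1),\qquad w=-\Big(2-\frac1{2t}-t\Big).$$ (ii) For some $(t,s)\in K^2$ with $s^2+ts+s=t^3+t^2$ (an affine equation of $X_1(15)$) and $$t(t+1)(t^2+t+1)(t^4+3t^3+4t^2+2t+1)(t^4-7t^3-6t^2+2t+1)\neq 0,$$ \begin{align*} u&=\frac{-1}{4(1+t)^6(1+t+t^2)^2}\Big(1+(8-6s)t+(30-14s+s^2)t^2-2(-39+11s+s^2)t^3+(143-16s+s^2)t^4\\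 &\qquad+4(49+s)t^5+(199+12s)t^6+2(70+3s)t^7+63t^8+14t^9+t^{10}\Big),\\ v&=\frac{-t^3(1+t)(1+t+3t^2+t^3)-st(-1-t-2t^2+t^4)}{(1+t)^6(1+t+t^2)},\\ w&=-\frac{1-(-4+s)t+(7+s)t^2+9t^3+5t^4+t^5}{2(1+t)^3(1+t+t^2)}. \end{align*} Then $f$ has a square root in $K((1/x))$, and the continued fraction of $\sqrt f$ (for either choice of the square root) is periodic with period $14$; moreover $a_{h+14}=a_h$ already for every $h\ge 1$. -/

import Mathlib

namespace PeriodicCF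

noncomputable section

open Polynomial

/-- The field `K((1/x))` is realised as `LaurentSeries K` in the uniformiser `T = 1/x`; a polynomial
in `x` is embedded by sending `x` to `T⁻¹`. -/
def embed {K : Type*} [Field K] : K[X] →+* LaurentSeries K :=
  Polynomial.eval₂RingHom HahnSeries.C (HahnSeries.single (-1 : ℤ) (1 : K))

/-- The polynomial part of `α ∈ K((1/x))`: the coefficient of `x ^ k`, `k ≥ 0`, is the coefficient
of `T ^ (-k)` in `α`. -/
def polyPart {K : Type*} [Field K] (α : LaurentSeries K) : K[X] :=
  ∑ k ∈ Finset.range ((-α.order).toNat + 1), Polynomial.monomial k (α.coeff (-(k : ℤ)))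

theorem coeff_polyPart {K : Type*} [Field K] (α : LaurentSeries K) (k : ℕ) :
    (polyPart α).coeff k = α.coeff (-(k : ℤ)) := by
  simp only [polyPart, Polynomial.finsetSum_coeff, Polynomial.coeff_monomial,
    Finset.sum_ite_eq', Finset.mem_range]
  split_ifs with h
  · rfl
  · exact (HahnSeries.coeff_eq_zero_of_lt_order (by omega)).symm

/-- The complete quotients: `α_0 = α` and `α_{h+1} = (α_h - a_h)⁻¹`. -/
def completeQuotient {K : Type*} [Field K] (α : LaurentSeries K) : ℕ → LaurentSeries K
  | 0 => α
  | h + 1 => (completeQuotient α h - embed (polyPart (completeQuotient α h)))⁻¹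

/-- The partial quotient `a_h`, the polynomial part of `α_h`. -/
def partialQuotient {K : Type*} [Field K] (α : LaurentSeries K) (h : ℕ) : K[X] :=
  polyPart (completeQuotient α h)

/-- The continued fraction algorithm never stops (no division by zero occurs). -/
def InfiniteCF {K : Type*} [Field K] (α : LaurentSeries K) : Prop :=
  ∀ h : ℕ, completeQuotient α h ≠ embed (partialQuotient α h)

/-- The continued fraction of `α` is periodic with period `n`: it is infinite, and `n` is the least
positive integer with `a_{h+n} = a_h` for every `h > 1`. -/
def HasCFPeriod {K : Type*} [Field K] (α : LaurentSeries K) (n : ℕ) : Prop :=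
  InfiniteCF α ∧
    IsLeast {m : ℕ | 0 < m ∧ ∀ h > 1, partialQuotient α (h + m) = partialQuotient α h} n

/-- `√f` exists in `K((1/x))`, and the continued fraction of either square root of `f` is periodic
with period `n`, the repetition starting already at `a_1`. -/
def SqrtHasCFPeriod {K : Type*} [Field K] (f : K[X]) (n : ℕ) : Prop :=
  (∃ y : LaurentSeries K, y ^ 2 = embed f) ∧
    ∀ y : LaurentSeries K, y ^ 2 = embed f →
      HasCFPeriod y n ∧ ∀ h ≥ 1, partialQuotient y (h + n) = partialQuotient y h

/-- The quartic `(x² + u)² - 4 v (x + w)`. -/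
def quartic {K : Type*} [Field K] (u v w : K) : K[X] :=
  (X ^ 2 + C u) ^ 2 - C (4 * v) * (X + C w)

end

/-- Coefficients of the first family, parametrised by `t`. -/
def u₁ {K : Type*} [Field K] (t : K) : K :=
  -4 - 1 / (4 * t ^ 2) + 2 / t + t + t ^ 2

def v₁ {K : Type*} [Field K] (t : K) : K :=
  (-1 + t) * (-1 + 2 * t)

def w₁ {K : Type*} [Field K] (t : K) : K :=
  -(2 - 1 / (2 * t) - t)

/-- Coefficients of the second family, parametrised by points `(t, s)` of
`s² + t s + s = t³ + t²`. -/
def u₂ {K : Type*} [Field K] (t s : K) : K :=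
  -1 / (4 * (1 + t) ^ 6 * (1 + t + t ^ 2) ^ 2) *
    (1 + (8 - 6 * s) * t + (30 - 14 * s + s ^ 2) * t ^ 2 - 2 * (-39 + 11 * s + s ^ 2) * t ^ 3
      + (143 - 16 * s + s ^ 2) * t ^ 4 + 4 * (49 + s) * t ^ 5 + (199 + 12 * s) * t ^ 6
      + 2 * (70 + 3 * s) * t ^ 7 + 63 * t ^ 8 + 14 * t ^ 9 + t ^ 10)

def v₂ {K : Type*} [Field K] (t s : K) : K :=
  (-t ^ 3 * (1 + t) * (1 + t + 3 * t ^ 2 + t ^ 3) - s * t * (-1 - t - 2 * t ^ 2 + t ^ 4)) /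
    ((1 + t) ^ 6 * (1 + t + t ^ 2))

def w₂ {K : Type*} [Field K] (t s : K) : K :=
  -((1 - (-4 + s) * t + (7 + s) * t ^ 2 + 9 * t ^ 3 + 5 * t ^ 4 + t ^ 5) /
    (2 * (1 + t) ^ 3 * (1 + t + t ^ 2)))

end PeriodicCF

/-! Put `A = X ^ 2 + C u`. The complete quotients of a root `y` of `f` are `(P_h + y) / Q_h` with
`Q_h Q_{h+1} = f - P_{h+1}²` and `a_h Q_h = P_h + P_{h+1}`. Here `P_h = A - d_h` for `h ≥ 1`, with
`d_h` constant, and each `Q_h` has degree at most 1, so the expansion reduces to scalar identities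
(`expansion`, `quartic_hasCFPeriod`). These are checked for seven steps; from there the sequence
runs backwards, so it repeats after 14 (`partialQuotient_of_palindrome`). The period is exactly 14
because `a_h = 2A` holds, for `h ≥ 1`, only when 14 divides `h`. In family (ii) all other partial
quotients are linear. In family (i) `Q_7` is a constant `κ` and `a_7 = (2 / κ) A`, so `κ ≠ 1` is
needed. Now `κ = 1` means that `t` is a root of a cubic irreducible over `ℚ`, impossible in a
quadratic field (`cubic_ne_zero`). -/

namespace PeriodicCF

noncomputable section

open Polynomial

/-! ### Polynomials inside `K((1/x))`: orders, polynomial parts and change of sign. -/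

section Embed

variable {K : Type*} [Field K]

theorem embed_C (r : K) : embed (C r) = HahnSeries.C r := by
  simp [embed]

theorem embed_X : embed (X : K[X]) = HahnSeries.single (-1 : ℤ) (1 : K) := by
  simp [embed]

theorem embed_monomial (n : ℕ) (r : K) :
    embed (monomial n r) = HahnSeries.single (-(n : ℤ)) r := by
  rw [← C_mul_X_pow_eq_monomial, map_mul, map_pow, embed_C, embed_X, HahnSeries.single_pow,
    HahnSeries.C_apply, HahnSeries.single_mul_single]
  simp

theorem coeff_embed (p : K[X]) (m : ℤ) :
    (embed p).coeff m = if m ≤ 0 then p.coeff (-m).toNat else 0 := by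
  induction p using Polynomial.induction_on' with
  | add p q hp hq =>
    rw [map_add, HahnSeries.coeff_add, hp, hq]
    split_ifs <;> simp
  | monomial n r =>
    rw [embed_monomial, HahnSeries.coeff_single, coeff_monomial]
    split_ifs <;> first | rfl | omega

theorem coeff_embed_neg (p : K[X]) (k : ℕ) : (embed p).coeff (-(k : ℤ)) = p.coeff k := by
  simp [coeff_embed]

theorem embed_injective : Function.Injective (embed : K[X] → LaurentSeries K) :=
  RingHom.injective_iff_ker_eq_bot _ |>.mpr <| (RingHom.ker_eq_bot_iff_eq_zero _).mpr fun p hp ↦ by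
    ext k
    rw [← coeff_embed_neg, hp]
    simp

theorem embed_ne_zero {p : K[X]} (hp : p ≠ 0) : embed p ≠ 0 :=
  (map_ne_zero_iff _ embed_injective).mpr hp

theorem orderTop_embed {p : K[X]} (hp : p ≠ 0) :
    (embed p).orderTop = ((-(p.natDegree : ℤ) : ℤ) : WithTop ℤ) := by
  apply le_antisymm
  · apply HahnSeries.orderTop_le_of_coeff_ne_zero
    rw [coeff_embed_neg]
    simpa using hp
  · rw [HahnSeries.le_orderTop_iff_forall]
    intro j hj
    rw [WithTop.coe_lt_coe] at hj
    rw [coeff_embed, if_pos (by omega)]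
    exact coeff_eq_zero_of_natDegree_lt (by omega)

theorem orderTop_div_pos {x y : LaurentSeries K} (hy : y ≠ 0) (h : y.orderTop < x.orderTop) :
    0 < (x / y).orderTop := by
  have hmul : (x / y).orderTop + y.orderTop = x.orderTop := by
    rw [← HahnSeries.orderTop_mul, div_mul_cancel₀ _ hy]
  rw [← hmul] at h
  by_contra hle
  exact absurd h (not_lt.mpr (add_le_of_nonpos_left (not_lt.mp hle)))

theorem polyPart_embed_add (p : K[X]) {ε : LaurentSeries K} (hε : 0 < ε.orderTop) :
    polyPart (embed p + ε) = p := by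
  ext k
  rw [coeff_polyPart, HahnSeries.coeff_add, coeff_embed_neg,
    HahnSeries.coeff_eq_zero_of_lt_orderTop, add_zero]
  refine lt_of_le_of_lt ?_ hε
  exact WithTop.coe_le_coe.mpr (by simp)

theorem polyPart_neg (α : LaurentSeries K) : polyPart (-α) = -polyPart α := by
  ext k
  simp [coeff_polyPart]

theorem completeQuotient_neg (α : LaurentSeries K) (h : ℕ) :
    completeQuotient (-α) h = -completeQuotient α h := by
  induction h with
  | zero => rfl
  | succ h ih =>
    rw [completeQuotient, completeQuotient, ih, polyPart_neg, map_neg, ← inv_neg]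
    congr 1
    ring

theorem partialQuotient_neg (α : LaurentSeries K) (h : ℕ) :
    partialQuotient (-α) h = -partialQuotient α h := by
  rw [partialQuotient, completeQuotient_neg, polyPart_neg, partialQuotient]

theorem HasCFPeriod.neg {α : LaurentSeries K} {n : ℕ} (hα : HasCFPeriod α n) :
    HasCFPeriod (-α) n := by
  simpa only [HasCFPeriod, InfiniteCF, completeQuotient_neg, partialQuotient_neg, map_neg,
    neg_inj, ne_eq] using hα

end Embed

/-! ### The continued fraction algorithm on quadratic irrationalities. -/

section Expansion

variable {K : Type*} [Field K]

/-- One step of the continued fraction algorithm for `(P + y) / Q`, where `y² = f`. -/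
theorem expansion_step {f P P' Q Q' a : K[X]} {y : LaurentSeries K} (hy : y ^ 2 = embed f)
    (hQ : Q ≠ 0) (hQ' : Q' ≠ 0) (hPQ : Q * Q' = f - P' ^ 2) (ha : a * Q = P + P')
    (hsmall : (embed Q).orderTop < (y - embed P').orderTop) :
    polyPart ((y + embed P) / embed Q) = a ∧
      (y + embed P) / embed Q ≠ embed a ∧
      ((y + embed P) / embed Q - embed a)⁻¹ = (y + embed P') / embed Q' := by
  have hQ0 := embed_ne_zero hQ
  have hQ0' := embed_ne_zero hQ'
  have hprod : (y - embed P') * (y + embed P') = embed Q * embed Q' := by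
    rw [← map_mul, hPQ, map_sub, map_pow, ← hy]
    ring
  have hε : (y + embed P) / embed Q - embed a = (y - embed P') / embed Q := by
    rw [eq_div_iff hQ0, sub_mul, div_mul_cancel₀ _ hQ0, ← map_mul, ha, map_add]
    ring
  have hne : y - embed P' ≠ 0 := by
    intro h
    rw [h, zero_mul] at hprod
    exact mul_ne_zero hQ0 hQ0' hprod.symm
  refine ⟨?_, ?_, ?_⟩
  · rw [← sub_add_cancel ((y + embed P) / embed Q) (embed a), add_comm, hε]
    apply polyPart_embed_add
    exact orderTop_div_pos hQ0 hsmall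
  · rw [← sub_ne_zero, hε]
    exact div_ne_zero hne hQ0
  · rw [hε, inv_div, div_eq_div_iff hne hQ0', ← hprod]
    ring

/-- The continued fraction expansion of a square root of `f`, from the sequences of polynomials in
its complete quotients `(P_h + y) / Q_h`. -/
theorem expansion {f : K[X]} {y : LaurentSeries K} (hy : y ^ 2 = embed f) (P Q a : ℕ → K[X])
    (hP₀ : P 0 = 0) (hQ₀ : Q 0 = 1) (hQ : ∀ h, Q h ≠ 0)
    (hPQ : ∀ h, Q h * Q (h + 1) = f - P (h + 1) ^ 2) (ha : ∀ h, a h * Q h = P h + P (h + 1))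
    (hsmall : ∀ h, (embed (Q h)).orderTop < (y - embed (P (h + 1))).orderTop) :
    InfiniteCF y ∧ ∀ h, partialQuotient y h = a h := by
  have step h := expansion_step hy (hQ h) (hQ (h + 1)) (hPQ h) (ha h) (hsmall h)
  have key : ∀ h, completeQuotient y h = (y + embed (P h)) / embed (Q h) := by
    intro h
    induction h with
    | zero => simp [completeQuotient, hP₀, hQ₀]
    | succ h ih => rw [completeQuotient, ih, (step h).1, (step h).2.2]
  have hpart : ∀ h, partialQuotient y h = a h := fun h ↦ by
    rw [partialQuotient, key, (step h).1]
  exact ⟨fun h ↦ by rw [hpart, key]; exact (step h).2.1, hpart⟩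

end Expansion

/-! ### Square roots of Laurent series close to 1. -/

section SquareRoot

variable {K : Type*} [Field K] [CharZero K]

/-- The root is the binomial series `(1 + X) ^ (1/2)` evaluated at `z - 1`, which converges since `z
- 1` has positive order. -/
theorem exists_sq_eq_of_orderTop_sub_one_pos {z : LaurentSeries K} (hz : 0 < (z - 1).orderTop) :
    ∃ r : LaurentSeries K, r ^ 2 = z := by
  refine ⟨PowerSeries.heval (z - 1) (PowerSeries.binomialSeries K (1 / 2 : K)), ?_⟩
  have h := PowerSeries.binomialSeries_add (A := K) (1 / 2 : K) (1 / 2)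
  have h₁ := PowerSeries.binomialSeries_nat (R := K) (A := K) 1
  rw [Nat.cast_one, pow_one] at h₁
  rw [add_halves, h₁] at h
  rw [← map_pow, sq, ← h, map_add, map_one, PowerSeries.heval_X _ hz]
  ring

end SquareRoot

/-! ### Back-and-forth walks on a path and palindromic expansions. -/

section Palindrome

/-- The position at time `h` of a walk that runs back and forth on the path `0, 1, …, n`. -/
def fold (n h : ℕ) : ℕ :=
  if h % (2 * n) ≤ n then h % (2 * n) else 2 * n - h % (2 * n)

theorem fold_le {n : ℕ} (hn : 0 < n) (h : ℕ) : fold n h ≤ n := by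
  have := Nat.mod_lt h (show 0 < 2 * n by omega)
  unfold fold
  split_ifs <;> omega

theorem fold_zero (n : ℕ) : fold n 0 = 0 := by
  simp [fold]

theorem fold_add_period (n h : ℕ) : fold n (h + 2 * n) = fold n h := by
  simp [fold]

theorem dvd_of_fold_eq_zero {n h : ℕ} (hn : 0 < n) (hh : fold n h = 0) : 2 * n ∣ h := by
  have := Nat.mod_lt h (show 0 < 2 * n by omega)
  apply Nat.dvd_of_mod_eq_zero
  unfold fold at hh
  split_ifs at hh <;> omega

theorem add_one_mod_cases {m : ℕ} (hm : 0 < m) (h : ℕ) :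
    (h % m + 1 < m ∧ (h + 1) % m = h % m + 1) ∨ (h % m + 1 = m ∧ (h + 1) % m = 0) := by
  have hlt := Nat.mod_lt h hm
  rcases Nat.lt_or_ge (h % m + 1) m with h1 | h1
  · left
    exact ⟨h1, by rw [← Nat.mod_add_mod, Nat.mod_eq_of_lt h1]⟩
  · right
    have h2 : h % m + 1 = m := by omega
    exact ⟨h2, by rw [← Nat.mod_add_mod, h2, Nat.mod_self]⟩

theorem fold_step {n : ℕ} (hn : 0 < n) (h : ℕ) :
    fold n (h + 1) = fold n h + 1 ∨ fold n h = fold n (h + 1) + 1 := by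
  unfold fold
  rcases add_one_mod_cases (show 0 < 2 * n by omega) h with ⟨h1, h2⟩ | ⟨h1, h2⟩ <;> rw [h2] <;>
    split_ifs <;> omega

theorem fold_step_step {n : ℕ} (hn : 0 < n) (h : ℕ) (h₀ : 0 < fold n (h + 1))
    (h₁ : fold n (h + 1) < n) : fold n h + fold n (h + 1 + 1) = 2 * fold n (h + 1) := by
  have hlt := Nat.mod_lt h (show 0 < 2 * n by omega)
  have h1 := add_one_mod_cases (show 0 < 2 * n by omega) h
  have h2 := add_one_mod_cases (show 0 < 2 * n by omega) (h + 1)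
  unfold fold at *
  generalize h % (2 * n) = r₀ at *
  generalize (h + 1) % (2 * n) = r₁ at *
  generalize (h + 1 + 1) % (2 * n) = r₂ at *
  split_ifs at * <;> omega

/-- The edge of the path that `fold` runs along between the times `h` and `h + 1`, labelled by its
larger end. -/
def foldEdge (n h : ℕ) : ℕ :=
  max (fold n h) (fold n (h + 1))

theorem foldEdge_zero {n : ℕ} (hn : 0 < n) : foldEdge n 0 = 1 := by
  have h1 := fold_step hn 0
  rw [fold_zero] at h1
  rw [foldEdge, fold_zero]
  omega

theorem fold_foldEdge {n : ℕ} (hn : 0 < n) (h : ℕ) : ∃ k < n, foldEdge n h = k + 1 ∧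
    (fold n h = k ∧ fold n (h + 1) = k + 1 ∨ fold n h = k + 1 ∧ fold n (h + 1) = k) := by
  have h1 := fold_le hn h
  have h2 := fold_le hn (h + 1)
  unfold foldEdge
  rcases fold_step hn h with h3 | h3
  · exact ⟨fold n h, by omega, by omega, by omega⟩
  · exact ⟨fold n (h + 1), by omega, by omega, by omega⟩

/-- The walk turns at `0`, turns at `n`, or passes through an inner vertex. `Q_h` sits on the
vertices and `P_h` on the edges, so these are the three shapes of the relation for `P_h + P_{h+1}`.
-/
theorem foldEdge_foldEdge {n : ℕ} (hn : 0 < n) (h : ℕ) :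
    (fold n (h + 1) = 0 ∧ foldEdge n h = 1 ∧ foldEdge n (h + 1) = 1) ∨
      (fold n (h + 1) = n ∧ foldEdge n h = n ∧ foldEdge n (h + 1) = n) ∨
      ∃ k < n, 0 < k ∧ fold n (h + 1) = k ∧
        (foldEdge n h = k ∧ foldEdge n (h + 1) = k + 1 ∨
          foldEdge n h = k + 1 ∧ foldEdge n (h + 1) = k) := by
  have h1 := fold_le hn h
  have h2 := fold_le hn (h + 1)
  have h3 := fold_le hn (h + 1 + 1)
  have h4 := fold_step hn h
  have h5 := fold_step hn (h + 1)
  unfold foldEdge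
  rcases Nat.eq_zero_or_pos (fold n (h + 1)) with h6 | h6
  · left
    omega
  rcases Nat.lt_or_ge (fold n (h + 1)) n with h7 | h7
  · have h8 := fold_step_step hn h h6 h7
    exact Or.inr (Or.inr ⟨fold n (h + 1), h7, h6, rfl, by omega⟩)
  · right
    left
    omega

/-- Since `a 0` differs from every other `a k`, it marks the visits to vertex `0`; any period must
carry one such visit to another, hence is a multiple of `2 * n`. -/
theorem hasCFPeriod_of_fold {K : Type*} [Field K] {n : ℕ} (hn : 0 < n) {y : LaurentSeries K} {a : ℕ → K[X]}
    (hinf : InfiniteCF y) (hpart : ∀ h ≥ 1, partialQuotient y h = a (fold n h))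
    (hne : ∀ k ≤ n, 0 < k → a k ≠ a 0) :
    HasCFPeriod y (2 * n) ∧ ∀ h ≥ 1, partialQuotient y (h + 2 * n) = partialQuotient y h := by
  have hper (h : ℕ) (hh : h ≥ 1) : partialQuotient y (h + 2 * n) = partialQuotient y h := by
    rw [hpart _ hh, hpart _ (by omega), fold_add_period]
  refine ⟨⟨hinf, ⟨by omega, fun h hh ↦ hper h (by omega)⟩, ?_⟩, hper⟩
  rintro m ⟨hm, hmper⟩
  -- Time `2 * n` stands in for time 0, which a period need not respect.
  have h1 := hmper (2 * n) (by omega)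
  have h2 : fold n (2 * n) = 0 := by simpa [fold_zero] using fold_add_period n 0
  rw [hpart _ (by omega), hpart _ (by omega), h2, add_comm, fold_add_period] at h1
  have h3 : fold n m = 0 := by
    by_contra h0
    exact hne _ (fold_le hn m) (Nat.pos_of_ne_zero h0) h1
  exact Nat.le_of_dvd hm (dvd_of_fold_eq_zero hn h3)

variable {K : Type*} [Field K] [CharZero K]

theorem natDegree_C_mul_sub_C {A : K[X]} (hA : A.natDegree = 2) (d : K) :
    (C 2 * A - C d).natDegree = 2 := by
  rw [natDegree_sub_C, natDegree_C_mul two_ne_zero, hA]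

theorem exists_sq_eq_embed {f A Q : K[X]} (hA : A.natDegree = 2) (hQ : Q ≠ 0)
    (hQd : Q.natDegree ≤ 1) (hf : Q = f - A ^ 2) : ∃ y : LaurentSeries K, y ^ 2 = embed f := by
  have hA0 : A ≠ 0 := by
    rintro rfl
    simp at hA
  have hA0' := embed_ne_zero (pow_ne_zero 2 hA0)
  have hz : 0 < ((1 + embed Q / embed (A ^ 2)) - 1).orderTop := by
    rw [add_sub_cancel_left]
    apply orderTop_div_pos hA0'
    rw [orderTop_embed hQ, orderTop_embed (pow_ne_zero 2 hA0), natDegree_pow, hA,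
      WithTop.coe_lt_coe]
    omega
  obtain ⟨r, hr⟩ := exists_sq_eq_of_orderTop_sub_one_pos hz
  refine ⟨embed A * r, ?_⟩
  rw [mul_pow, hr, mul_add, mul_one, ← map_pow, mul_div_cancel₀ _ hA0', ← map_add, hf]
  congr 1
  ring

/-- The two factors `±y - A` sum to `-2A`, of order -2, so one of them has order at most -2; their
product `-Q` has order at least -1, which forces the other to have positive order. -/
theorem orderTop_sub_or_orderTop_neg_sub_pos {f A Q : K[X]} (hA : A.natDegree = 2) (hQ : Q ≠ 0)
    (hQd : Q.natDegree ≤ 1) (hf : Q = f - A ^ 2) {y : LaurentSeries K} (hy : y ^ 2 = embed f) :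
    0 < (y - embed A).orderTop ∨ 0 < (-y - embed A).orderTop := by
  have hprod : (y - embed A) * (-y - embed A) = -embed Q := by
    rw [hf, map_sub, map_pow, ← hy]
    ring
  have hQ0 := neg_ne_zero.mpr (embed_ne_zero hQ)
  obtain ⟨hp, hq⟩ := mul_ne_zero_iff.mp (hprod ▸ hQ0)
  have hsum : (y - embed A) + (-y - embed A) = -embed (C 2 * A - C 0) := by
    simp only [map_sub, map_mul, map_zero, map_ofNat]
    ring
  have hd := natDegree_C_mul_sub_C hA 0
  have hne : C 2 * A - C 0 ≠ 0 := ne_zero_of_natDegree_gt (n := 1) (by omega)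
  have h1 := HahnSeries.min_orderTop_le_orderTop_add (x := y - embed A) (y := -y - embed A)
  have h2 := congrArg HahnSeries.orderTop hprod
  rw [hsum, HahnSeries.orderTop_neg, orderTop_embed hne, hd] at h1
  rw [HahnSeries.orderTop_mul, HahnSeries.orderTop_neg, orderTop_embed hQ] at h2
  rw [← HahnSeries.order_eq_orderTop_of_ne_zero hp, ← HahnSeries.order_eq_orderTop_of_ne_zero hq]
    at *
  norm_cast at *
  omega

/-- With `P' = A - d`, the series `y + P'` has order -2 because `y` is close to `A`. From `(y -
P')(y + P') = Q Q'` the order of `y - P'` is that of `Q` plus `2 - deg Q'`, and `deg Q' ≤ 1`. -/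
theorem orderTop_embed_lt_sub {f A Q Q' : K[X]} (hA : A.natDegree = 2) (hQ : Q ≠ 0)
    (hQ' : Q' ≠ 0) (hQd : Q'.natDegree ≤ 1) {d : K} (hf : Q * Q' = f - (A - C d) ^ 2)
    {y : LaurentSeries K} (hy : y ^ 2 = embed f) (hyA : 0 < (y - embed A).orderTop) :
    (embed Q).orderTop < (y - embed (A - C d)).orderTop := by
  have hprod : (y - embed (A - C d)) * (y + embed (A - C d)) = embed Q * embed Q' := by
    rw [← map_mul, hf, map_sub _ f, map_pow, ← hy]
    ring
  have hsum : y + embed (A - C d) = embed (C 2 * A - C d) + (y - embed A) := by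
    simp only [map_sub, map_mul, map_ofNat]
    ring
  have hd := natDegree_C_mul_sub_C hA d
  have hne : C 2 * A - C d ≠ 0 := ne_zero_of_natDegree_gt (n := 1) (by omega)
  have hplus : (y + embed (A - C d)).orderTop = ((-2 : ℤ) : WithTop ℤ) := by
    rw [hsum, HahnSeries.orderTop_add_eq_left, orderTop_embed hne, hd]
    · rfl
    · rw [orderTop_embed hne, hd]
      exact lt_trans (WithTop.coe_lt_coe.mpr (by norm_num)) hyA
  have hQ0 := mul_ne_zero (embed_ne_zero hQ) (embed_ne_zero hQ')
  obtain ⟨hp, -⟩ := mul_ne_zero_iff.mp (hprod ▸ hQ0)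
  have h2 := congrArg HahnSeries.orderTop hprod
  rw [HahnSeries.orderTop_mul, HahnSeries.orderTop_mul, hplus, orderTop_embed hQ,
    orderTop_embed hQ'] at h2
  rw [orderTop_embed hQ]
  rw [← HahnSeries.order_eq_orderTop_of_ne_zero hp] at *
  norm_cast at *
  omega

/-- A palindromic system of relations of length `n` yields the continued fraction expansion of the
square root of `f` with polynomial part `A`. -/
theorem partialQuotient_of_palindrome {n : ℕ} (hn : 0 < n) {f A : K[X]} (hA : A.natDegree = 2)
    (Q a : ℕ → K[X]) (d : ℕ → K) (hQ₀ : Q 0 = 1) (hQ : ∀ k ≤ n, Q k ≠ 0)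
    (hQd : ∀ k ≤ n, (Q k).natDegree ≤ 1) (hd : d 1 = 0)
    (hQQ : ∀ k < n, Q k * Q (k + 1) = f - (A - C (d (k + 1))) ^ 2)
    (ha₀ : a 0 = C 2 * A) (han : a n * Q n = C 2 * A - C (d n + d n))
    (ha : ∀ k < n, 0 < k → a k * Q k = C 2 * A - C (d k + d (k + 1)))
    {y : LaurentSeries K} (hy : y ^ 2 = embed f) (hyA : 0 < (y - embed A).orderTop) :
    InfiniteCF y ∧ ∀ h ≥ 1, partialQuotient y h = a (fold n h) := by
  have hQQ' (h : ℕ) : Q (fold n h) * Q (fold n (h + 1)) = f - (A - C (d (foldEdge n h))) ^ 2 := by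
    obtain ⟨k, hk, h1, ⟨h2, h3⟩ | ⟨h2, h3⟩⟩ := fold_foldEdge hn h
    · rw [h1, h2, h3, hQQ k hk]
    · rw [h1, h2, h3, mul_comm, hQQ k hk]
  have ha' (h : ℕ) : a (fold n (h + 1)) * Q (fold n (h + 1)) =
      (A - C (d (foldEdge n h))) + (A - C (d (foldEdge n (h + 1)))) := by
    have hsum (r s : K) : (A - C r) + (A - C s) = C 2 * A - C (r + s) := by
      rw [map_add, show (C 2 : K[X]) = 2 from rfl]
      ring
    rw [hsum]
    obtain ⟨h1, h2, h3⟩ | ⟨h1, h2, h3⟩ | ⟨k, hk, hk₀, h1, ⟨h2, h3⟩ | ⟨h2, h3⟩⟩ :=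
      foldEdge_foldEdge hn h
    · rw [h1, h2, h3, ha₀, hQ₀, hd]
      simp
    · rw [h1, h2, h3, han]
    · rw [h1, h2, h3, ha k hk hk₀]
    · rw [h1, h2, h3, ha k hk hk₀, add_comm]
  obtain ⟨hinf, hpart⟩ := expansion hy
    -- Time 0 is exceptional: `P_0 = 0` and `a_0 = A`, whereas every later visit to vertex `0` has
    -- `P_h = A` and partial quotient `2A`.
    (fun h ↦ if h = 0 then 0 else A - C (d (foldEdge n (h - 1)))) (fun h ↦ Q (fold n h))
    (fun h ↦ if h = 0 then A else a (fold n h)) (if_pos rfl) (by simp only [fold_zero, hQ₀])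
    (fun h ↦ hQ _ (fold_le hn h)) (fun h ↦ by simpa using hQQ' h)
    (fun h ↦ by
      cases h with
      | zero => simp [fold_zero, hQ₀, foldEdge_zero hn, hd]
      | succ h => simpa using ha' h)
    (fun h ↦ by
      simpa using orderTop_embed_lt_sub hA (hQ _ (fold_le hn h)) (hQ _ (fold_le hn (h + 1)))
        (hQd _ (fold_le hn (h + 1))) (hQQ' h) hy hyA)
  exact ⟨hinf, fun h hh ↦ by rw [hpart, if_neg (by omega)]⟩

theorem sqrtHasCFPeriod_of_palindrome {n : ℕ} (hn : 0 < n) {f A : K[X]} (hA : A.natDegree = 2)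
    (Q a : ℕ → K[X]) (d : ℕ → K) (hQ₀ : Q 0 = 1) (hQ : ∀ k ≤ n, Q k ≠ 0)
    (hQd : ∀ k ≤ n, (Q k).natDegree ≤ 1) (hd : d 1 = 0)
    (hQQ : ∀ k < n, Q k * Q (k + 1) = f - (A - C (d (k + 1))) ^ 2)
    (ha₀ : a 0 = C 2 * A) (han : a n * Q n = C 2 * A - C (d n + d n))
    (ha : ∀ k < n, 0 < k → a k * Q k = C 2 * A - C (d k + d (k + 1)))
    (hne : ∀ k ≤ n, 0 < k → a k ≠ a 0) :
    SqrtHasCFPeriod f (2 * n) := by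
  have hQ₁ : Q 1 = f - A ^ 2 := by simpa [hQ₀, hd] using hQQ 0 hn
  have main (y : LaurentSeries K) (hy : y ^ 2 = embed f) (hyA : 0 < (y - embed A).orderTop) :
      HasCFPeriod y (2 * n) ∧
        ∀ h ≥ 1, partialQuotient y (h + 2 * n) = partialQuotient y h := by
    obtain ⟨hinf, hpart⟩ :=
      partialQuotient_of_palindrome hn hA Q a d hQ₀ hQ hQd hd hQQ ha₀ han ha hy hyA
    exact hasCFPeriod_of_fold hn hinf hpart hne
  refine ⟨exists_sq_eq_embed hA (hQ 1 hn) (hQd 1 hn) hQ₁, fun y hy ↦ ?_⟩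
  rcases orderTop_sub_or_orderTop_neg_sub_pos hA (hQ 1 hn) (hQd 1 hn) hQ₁ hy with h | h
  · exact main y hy h
  · obtain ⟨h1, h2⟩ := main (-y) (by rw [neg_sq, hy]) h
    refine ⟨neg_neg y ▸ h1.neg, fun h hh ↦ ?_⟩
    simpa only [partialQuotient_neg, neg_inj] using h2 h hh

end Palindrome

/-! ### Reduction of the expansion to scalar recurrences. -/

section Quartic

variable {K : Type*} [Field K]

/-- Linear denominators `q (X + w)` and the conditions on `d` and `w` under which consecutive ones
satisfy the relations of the continued fraction expansion of the quartic. -/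
theorem quartic_mul_linear {u v w₀ d q q' w w' : K} (hq : q * q' = 2 * d)
    (hw : d * (w + w') = -2 * v)
    (hd : 2 * d * w ^ 2 + 4 * v * w + 2 * d * u - d ^ 2 - 4 * v * w₀ = 0) :
    C q * (X + C w) * (C q' * (X + C w')) = quartic u v w₀ - (X ^ 2 + C u - C d) ^ 2 := by
  have hp : 2 * d * (w * w') = 2 * d * u - d ^ 2 - 4 * v * w₀ := by
    linear_combination 2 * w * hw - hd
  have e1 : C q * (X + C w) * (C q' * (X + C w')) =
      C (q * q') * X ^ 2 + C (q * q' * (w + w')) * X + C (q * q' * (w * w')) := by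
    simp only [map_mul, map_add]
    ring
  rw [e1, hq, hp, show 2 * d * (w + w') = -4 * v by linear_combination 2 * hw, quartic]
  simp only [map_mul, map_sub, map_neg, map_pow, map_ofNat]
  ring

theorem mul_linear {u d d' q w : K} (hq : q ≠ 0) (h : d + d' = 2 * w ^ 2 + 2 * u) :
    C (2 / q) * (X - C w) * (C q * (X + C w)) = C 2 * (X ^ 2 + C u) - C (d + d') := by
  have e1 : C (2 / q) * (X - C w) * (C q * (X + C w)) =
      C (2 / q * q) * (X ^ 2 - C w ^ 2) := by
    simp only [map_mul]
    ring
  rw [e1, div_mul_cancel₀ _ hq, h]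
  simp only [map_mul, map_add, map_pow, map_ofNat]
  ring

theorem natDegree_linear_le (q w : K) : (C q * (X + C w)).natDegree ≤ 1 := by
  refine (natDegree_C_mul_le _ _).trans ?_
  simp

theorem linear_ne_zero {q : K} (hq : q ≠ 0) (w : K) : C q * (X + C w) ≠ 0 :=
  mul_ne_zero (C_ne_zero.mpr hq) (X_add_C_ne_zero w)

theorem natDegree_sq_add_C (u : K) : (X ^ 2 + C u : K[X]).natDegree = 2 :=
  natDegree_X_pow_add_C

/-- The relation says that `-w k` is a root of `f - (A - d (k + 1))²`. It is quadratic in `d` and in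
`w`, and `hd`, `hw` are the Vieta sums: replacing `d` or `w` in turn by the other root carries the
relation along the chain from the trivial case `d 1 = 0`. -/
theorem root_relation {u v : K} {d w : ℕ → K} {m : ℕ} (hd₁ : d 1 = 0)
    (hd : ∀ k < m, 0 < k → d k + d (k + 1) = 2 * w k ^ 2 + 2 * u)
    (hw : ∀ k < m, 1 < k → d k * (w (k - 1) + w k) = -2 * v) (k : ℕ) (hk : k < m) (hk₀ : 0 < k) :
    2 * d (k + 1) * w k ^ 2 + 4 * v * w k + 2 * d (k + 1) * u - d (k + 1) ^ 2 - 4 * v * w 1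
      = 0 := by
  have step (j : ℕ) (hj : j < m) (hj₀ : 0 < j)
      (h : 2 * d j * w j ^ 2 + 4 * v * w j + 2 * d j * u - d j ^ 2 - 4 * v * w 1 = 0) :
      2 * d (j + 1) * w j ^ 2 + 4 * v * w j + 2 * d (j + 1) * u - d (j + 1) ^ 2 - 4 * v * w 1
        = 0 := by
    linear_combination h + (d j - d (j + 1)) * hd j hj hj₀
  induction k, hk₀ using Nat.le_induction with
  | base =>
    refine step 1 hk one_pos ?_
    rw [hd₁]
    ring
  | succ j hj ih =>
    refine step (j + 1) hk (by omega) ?_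
    have h1 := ih (by omega)
    have h2 := hw (j + 1) hk (by omega)
    rw [Nat.add_sub_cancel] at h2
    linear_combination h1 + 2 * (w (j + 1) - w j) * h2

/-- The leading coefficients are determined recursively by `q (k + 1) = 2 d (k + 1) / q k`, so they
need no closed form. -/
theorem exists_alternating_quotients {c : K} (hc : c ≠ 0) {d : ℕ → K} {m : ℕ}
    (hd : ∀ k < m, 1 < k → d k ≠ 0) (h2 : (2 : K) ≠ 0) :
    ∃ q : ℕ → K, q 1 = c ∧ (∀ k < m, 0 < k → q k ≠ 0) ∧
      ∀ k, 0 < k → k + 1 < m → q k * q (k + 1) = 2 * d (k + 1) := by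
  -- The shift to `k - 1` starts the recursion at index 1; the value at 0 plays no role.
  let q : ℕ → K := fun k ↦ Nat.rec c (fun j r ↦ 2 * d (j + 2) / r) (k - 1)
  have hstep (k : ℕ) (hk : 0 < k) : q (k + 1) = 2 * d (k + 1) / q k := by
    obtain ⟨j, rfl⟩ := Nat.exists_eq_add_of_lt hk
    simp [q]
  have hq (k : ℕ) (hk : k < m) (hk₀ : 0 < k) : q k ≠ 0 := by
    induction k, hk₀ using Nat.le_induction with
    | base => exact hc
    | succ j hj ih =>
      rw [hstep j hj]
      exact div_ne_zero (mul_ne_zero h2 (hd _ hk (by omega))) (ih (by omega))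
  refine ⟨q, rfl, hq, fun k hk hkm ↦ ?_⟩
  rw [hstep k hk, mul_div_cancel₀ _ (hq k (by omega) hk)]

variable [CharZero K]

/-- The expansion of the square root of a quartic whose denominators are linear, except possibly
for the middle one of the palindrome. -/
theorem quartic_hasCFPeriod {m : ℕ} (hm : 1 < m) {u v : K} {d w q : ℕ → K} (hd₁ : d 1 = 0)
    (hq₁ : q 1 = -(4 * v)) (hq : ∀ k < m, 0 < k → q k ≠ 0)
    (hqq : ∀ k, 0 < k → k + 1 < m → q k * q (k + 1) = 2 * d (k + 1))
    (hd : ∀ k < m, 0 < k → d k + d (k + 1) = 2 * w k ^ 2 + 2 * u)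
    (hw : ∀ k < m, 1 < k → d k * (w (k - 1) + w k) = -2 * v)
    {Q a : K[X]} (hQ : Q ≠ 0) (hQd : Q.natDegree ≤ 1)
    (hQQ : C (q (m - 1)) * (X + C (w (m - 1))) * Q =
      quartic u v (w 1) - (X ^ 2 + C u - C (d m)) ^ 2)
    (ha : a * Q = C 2 * (X ^ 2 + C u) - C (d m + d m)) (hne : a ≠ C 2 * (X ^ 2 + C u)) :
    SqrtHasCFPeriod (quartic u v (w 1)) (2 * m) := by
  have hA := natDegree_sq_add_C u
  refine sqrtHasCFPeriod_of_palindrome (by omega) hA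
    (fun k ↦ if k = 0 then 1 else if k < m then C (q k) * (X + C (w k)) else Q)
    (fun k ↦ if k = 0 then C 2 * (X ^ 2 + C u) else
      if k < m then C (2 / q k) * (X - C (w k)) else a) d
    (if_pos rfl) (fun k hk ↦ ?_) (fun k hk ↦ ?_) hd₁ (fun k hk ↦ ?_) (if_pos rfl) ?_
    (fun k hk hk₀ ↦ ?_) (fun k hk hk₀ ↦ ?_)
  · split_ifs with h1 h2
    · exact one_ne_zero
    · exact linear_ne_zero (hq k h2 (by omega)) _
    · exact hQ
  · split_ifs with h1 h2
    · simp
    · exact natDegree_linear_le _ _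
    · exact hQd
  · rcases Nat.eq_zero_or_pos k with rfl | hk₀
    · rw [if_pos rfl, if_neg (by omega), if_pos (by omega), zero_add, hq₁, hd₁, quartic]
      simp only [map_mul, map_neg, map_zero, map_ofNat]
      ring
    rw [if_neg (by omega), if_pos hk, if_neg (by omega)]
    split_ifs with h1
    · refine quartic_mul_linear (hqq k hk₀ h1) ?_ (root_relation hd₁ hd hw k hk hk₀)
      simpa using hw (k + 1) h1 (by omega)
    · obtain rfl : m = k + 1 := by omega
      exact hQQ
  · rw [if_neg (by omega), if_neg (by omega), if_neg (by omega), if_neg (by omega), ha]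
  · rw [if_neg (by omega), if_pos hk, if_neg (by omega), if_pos hk]
    exact mul_linear (hq k hk hk₀) (hd k hk hk₀)
  · rw [if_neg (by omega), if_pos rfl]
    split_ifs with h1
    · intro h2
      have h3 := congrArg natDegree h2
      rw [natDegree_C_mul two_ne_zero, hA,
        natDegree_C_mul (div_ne_zero two_ne_zero (hq k h1 hk₀)), natDegree_X_sub_C] at h3
      omega
    · exact hne

/-- Middle denominator of degree 0: `d m = 0` and `w (m - 1) = w 1` make `Q_m` the constant `κ`, and
`κ ≠ 1` separates `a_m = (2 / κ) A` from `2A`. -/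
theorem quartic_hasCFPeriod_of_const {m : ℕ} (hm : 1 < m) {u v : K} {d w q : ℕ → K} (hd₁ : d 1 = 0)
    (hq₁ : q 1 = -(4 * v)) (hq : ∀ k < m, 0 < k → q k ≠ 0)
    (hqq : ∀ k, 0 < k → k + 1 < m → q k * q (k + 1) = 2 * d (k + 1))
    (hd : ∀ k < m, 0 < k → d k + d (k + 1) = 2 * w k ^ 2 + 2 * u)
    (hw : ∀ k < m, 1 < k → d k * (w (k - 1) + w k) = -2 * v)
    (hdm : d m = 0) (hwm : w (m - 1) = w 1) {κ : K} (hκ : q (m - 1) * κ = -(4 * v))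
    (hκ₀ : κ ≠ 0) (hκ₁ : κ ≠ 1) :
    SqrtHasCFPeriod (quartic u v (w 1)) (2 * m) := by
  have hA := natDegree_sq_add_C u
  refine quartic_hasCFPeriod hm hd₁ hq₁ hq hqq hd hw (Q := C κ) (a := C (2 / κ) * (X ^ 2 + C u))
    (C_ne_zero.mpr hκ₀) (by simp) ?_ ?_ ?_
  · rw [mul_right_comm, ← map_mul, hκ, hwm, hdm, quartic]
    simp only [map_mul, map_neg, map_zero, map_ofNat]
    ring
  · rw [mul_right_comm, ← map_mul, div_mul_cancel₀ _ hκ₀, hdm]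
    simp
  · intro h
    have h1 := C_injective (mul_right_cancel₀ (ne_zero_of_natDegree_gt (n := 1) (by omega)) h)
    rw [div_eq_iff hκ₀] at h1
    exact hκ₁ (mul_left_cancel₀ two_ne_zero (by rw [← h1, mul_one]))

/-- Middle denominator of degree 1: `hdm` is the recurrence for `d` with `d (m + 1) = d m`, the
reflection at `m`. Minimality follows by comparing degrees. -/
theorem quartic_hasCFPeriod_of_linear {m : ℕ} (hm : 1 < m) {u v : K} {d w : ℕ → K} (hv : v ≠ 0)
    (hd₁ : d 1 = 0) (hd₀ : ∀ k < m + 1, 1 < k → d k ≠ 0)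
    (hd : ∀ k < m, 0 < k → d k + d (k + 1) = 2 * w k ^ 2 + 2 * u)
    (hw : ∀ k < m + 1, 1 < k → d k * (w (k - 1) + w k) = -2 * v)
    (hdm : d m + d m = 2 * w m ^ 2 + 2 * u) :
    SqrtHasCFPeriod (quartic u v (w 1)) (2 * m) := by
  have hA := natDegree_sq_add_C u
  obtain ⟨q, hq₁, hq, hqq⟩ := exists_alternating_quotients (c := -(4 * v))
    (neg_ne_zero.mpr (mul_ne_zero (OfNat.ofNat_ne_zero 4) hv)) hd₀ two_ne_zero
  have hqm := hq m (by omega) (by omega)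
  have hw' : ∀ k < m, 1 < k → d k * (w (k - 1) + w k) = -2 * v := fun k hk ↦ hw k (by omega)
  refine quartic_hasCFPeriod hm hd₁ hq₁ (fun k hk ↦ hq k (by omega))
    (fun k hk hk' ↦ hqq k hk (by omega)) hd hw'
    (Q := C (q m) * (X + C (w m))) (a := C (2 / q m) * (X - C (w m)))
    (linear_ne_zero hqm _) (natDegree_linear_le _ _) ?_ (mul_linear hqm hdm) ?_
  · have h1 := hqq (m - 1) (by omega) (by omega)
    have h2 := root_relation hd₁ hd hw' (m - 1) (by omega) (by omega)
    rw [Nat.sub_add_cancel (by omega)] at h1 h2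
    exact quartic_mul_linear h1 (hw m (by omega) hm) h2
  · intro h2
    have h3 := congrArg natDegree h2
    rw [natDegree_C_mul two_ne_zero, hA,
      natDegree_C_mul (div_ne_zero two_ne_zero hqm), natDegree_X_sub_C] at h3
    omega

end Quartic

/-! ### A cubic with no root in a quadratic field. -/

theorem cubic_ne_zero_rat (r : ℚ) : 15 * r ^ 3 - 32 * r ^ 2 + 20 * r - 4 ≠ 0 := by
  intro h
  have hden : (r.den : ℚ) ≠ 0 := Nat.cast_ne_zero.mpr r.den_nz
  have h1 : 15 * (r.num : ℚ) ^ 3 - 32 * r.num ^ 2 * r.den + 20 * r.num * r.den ^ 2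
      - 4 * r.den ^ 3 = 0 := by
    rw [← Rat.num_div_den r] at h
    field_simp at h
    linear_combination h
  have h2 : 15 * r.num ^ 3 - 32 * r.num ^ 2 * r.den + 20 * r.num * r.den ^ 2
      - 4 * (r.den : ℤ) ^ 3 = 0 := by
    exact_mod_cast h1
  -- The homogenised cubic has only the trivial zero modulo 11, so 11 would divide both numerator
  -- and denominator.
  have h3 := congrArg (Int.cast : ℤ → ZMod 11) h2
  push_cast at h3
  have key : ∀ a b : ZMod 11, 15 * a ^ 3 - 32 * a ^ 2 * b + 20 * a * b ^ 2 - 4 * b ^ 3 = 0 →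
      a = 0 ∧ b = 0 := by
    decide
  obtain ⟨h4, h5⟩ := key _ _ h3
  have h6 : (11 : ℤ) ∣ r.num := (ZMod.intCast_zmod_eq_zero_iff_dvd _ 11).mp h4
  have h7 : 11 ∣ r.den := (ZMod.natCast_eq_zero_iff _ 11).mp h5
  have h8 := Nat.dvd_gcd (Int.natAbs_dvd_natAbs.mpr h6) h7
  rw [r.reduced] at h8
  norm_num at h8

theorem natDegree_dvd_finrank_of_irreducible {F L : Type*} [Field F] [Field L] [Algebra F L]
    [FiniteDimensional F L] {p : F[X]} (hp : Irreducible p) {x : L} (hx : aeval x p = 0) :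
    p.natDegree ∣ Module.finrank F L := by
  have h := minpoly.degree_dvd (IsIntegral.of_finite F x)
  rwa [← minpoly.eq_of_irreducible hp hx, natDegree_mul_C
    (inv_ne_zero (leadingCoeff_ne_zero.mpr hp.ne_zero))] at h

theorem cubic_ne_zero {K : Type*} [Field K] [NumberField K] (hK : Module.finrank ℚ K = 2) (t : K) :
    15 * t ^ 3 - 32 * t ^ 2 + 20 * t - 4 ≠ 0 := by
  intro ht
  let p : ℚ[X] := C 15 * X ^ 3 + C (-32) * X ^ 2 + C 20 * X + C (-4)
  have hp : p.natDegree = 3 := natDegree_cubic (by norm_num)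
  have hirr : Irreducible p := by
    refine irreducible_of_degree_le_three_of_not_isRoot (by rw [hp]; decide) fun r hr ↦ ?_
    refine cubic_ne_zero_rat r ?_
    simp only [p, IsRoot.def, eval_add, eval_mul, eval_C, eval_pow, eval_X] at hr
    linear_combination hr
  have h := natDegree_dvd_finrank_of_irreducible hirr (x := t) (by
    simp only [p, map_add, map_mul, map_pow, aeval_X, map_neg, map_ofNat]
    linear_combination ht)
  rw [hp, hK] at h
  norm_num at h

/-! ### The family with one parameter. -/

section FirstFamily

variable {K : Type*} [Field K]

/-- The constants `u - e_h`, where `x² + e_h` are the numerators in the complete quotients for the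
first family. -/
def firstShift (t : K) : ℕ → K
  | 2 => 2 * (t - 1) * (2 * t - 1)
  | 3 => 2 * (t - 1) * (2 * t - 1) / t
  | 4 => 2 * t * (t - 1)
  | 5 => 2 * (t - 1) * (2 * t - 1) / t
  | 6 => 2 * (t - 1) * (2 * t - 1)
  | _ => 0

/-- The constants `w_h`, where `q_h (x + w_h)` are the denominators in the complete quotients for
the first family. -/
def firstRoot (t : K) : ℕ → K
  | 2 => -(t ^ 2 - t + 1 / 2) / t
  | 3 => -(2 * t - 1) / (2 * t)
  | 4 => -(2 * t - 1) / (2 * t)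
  | 5 => -(t ^ 2 - t + 1 / 2) / t
  | _ => w₁ t

/-- The constants `q_h`, where `q_h (x + w_h)` are the denominators in the complete quotients for
the first family. -/
def firstLeading (t : K) : ℕ → K
  | 1 => -4 * (t - 1) * (2 * t - 1)
  | 2 => -1
  | 3 => -4 * (t - 1) * (2 * t - 1) / t
  | 4 => -t ^ 2 / (2 * t - 1)
  | 5 => -4 * (t - 1) * (2 * t - 1) ^ 2 / t ^ 3
  | _ => -t ^ 3 / (2 * t - 1)

theorem firstLeading_ne_zero [CharZero K] {t : K} (ht : t ≠ 0) (ht₁ : t - 1 ≠ 0)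
    (ht₂ : 2 * t - 1 ≠ 0) (k : ℕ) : firstLeading t k ≠ 0 := by
  have h4 : (4 : K) ≠ 0 := OfNat.ofNat_ne_zero 4
  unfold firstLeading
  split <;> simp [ht, ht₁, ht₂, h4]

theorem firstLeading_mul {t : K} (ht : t ≠ 0) (ht₂ : 2 * t - 1 ≠ 0) (k : ℕ) (hk₀ : 0 < k)
    (hk : k + 1 < 7) : firstLeading t k * firstLeading t (k + 1) = 2 * firstShift t (k + 1) := by
  obtain ⟨h1, h2⟩ : 1 ≤ k ∧ k ≤ 5 := by omega
  interval_cases k <;> simp only [firstLeading, firstShift] <;> generalize 2 * t - 1 = x at * <;>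
    field_simp <;> ring

theorem firstShift_add [CharZero K] {t : K} (ht : t ≠ 0) (k : ℕ) (hk : k < 7) (hk₀ : 0 < k) :
    firstShift t k + firstShift t (k + 1) = 2 * firstRoot t k ^ 2 + 2 * u₁ t := by
  interval_cases k <;> simp only [firstRoot, firstShift, u₁, w₁] <;> field_simp <;> ring

theorem firstShift_mul [CharZero K] {t : K} (ht : t ≠ 0) (k : ℕ) (hk : k < 7) (hk₁ : 1 < k) :
    firstShift t k * (firstRoot t (k - 1) + firstRoot t k) = -2 * v₁ t := by
  interval_cases k <;> simp only [firstRoot, firstShift, v₁, w₁] <;> field_simp <;> ring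

theorem sqrtHasCFPeriod_first [CharZero K] {t : K} (h : t * (t - 1) * (2 * t - 1) ≠ 0)
    (hcubic : 15 * t ^ 3 - 32 * t ^ 2 + 20 * t - 4 ≠ 0) :
    SqrtHasCFPeriod (quartic (u₁ t) (v₁ t) (w₁ t)) 14 := by
  obtain ⟨⟨ht, ht₁⟩, ht₂⟩ : (t ≠ 0 ∧ t - 1 ≠ 0) ∧ 2 * t - 1 ≠ 0 := by
    simpa only [mul_ne_zero_iff] using h
  have h4 : (4 : K) ≠ 0 := OfNat.ofNat_ne_zero 4
  -- This `κ` is `-4 v₁ / q_6`; clearing denominators in `κ = 1` gives exactly the excluded cubic.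
  have hκ₁ : 4 * (t - 1) * (2 * t - 1) ^ 2 / t ^ 3 ≠ 1 := by
    rw [Ne, div_eq_one_iff_eq (pow_ne_zero 3 ht)]
    intro h1
    exact hcubic (by linear_combination h1)
  refine quartic_hasCFPeriod_of_const (m := 7) (w := firstRoot t) (q := firstLeading t)
    (by norm_num) rfl ?_ (fun k _ _ ↦ firstLeading_ne_zero ht ht₁ ht₂ k) (firstLeading_mul ht ht₂)
    (firstShift_add ht) (firstShift_mul ht) rfl rfl (κ := 4 * (t - 1) * (2 * t - 1) ^ 2 / t ^ 3)
    ?_ (by simp [ht, ht₁, ht₂, h4]) hκ₁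
  · simp only [firstLeading, v₁]
    ring
  · simp only [firstLeading, v₁]
    field_simp
    ring

end FirstFamily

/-! ### The family parametrised by `X_1(15)`. -/

section SecondFamily

variable {K : Type*} [Field K]

/-- The constants `u - e_h`, where `x² + e_h` are the numerators in the complete quotients for the
second family, multiplied by `(1 + t) ^ 6 * (1 + t + t ^ 2) ^ 2`. -/
def secondShift (t s : K) : ℕ → K
  | 2 => 2 * (1 + t + t ^ 2) *
      (-t ^ 3 * (1 + t) * (1 + t + 3 * t ^ 2 + t ^ 3) - s * t * (-1 - t - 2 * t ^ 2 + t ^ 4))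
  | 3 => 2 * t * (1 + t) ^ 3 * (1 + t + t ^ 2) * (s * (1 - t) - t ^ 2 * (2 + t))
  | 4 => -2 * t * (1 + t) * (1 + t + t ^ 2) ^ 2 * (s * t + (1 + 2 * t + 3 * t ^ 2 + t ^ 3))
  | 5 => 2 * (1 + t) ^ 2 *
      (-t ^ 3 * (1 + t) * (1 + t + 3 * t ^ 2 + t ^ 3) - s * t * (-1 - t - 2 * t ^ 2 + t ^ 4))
  | 6 => 2 * t * (1 + t) * (1 + t + t ^ 2) ^ 2 * (s - t ^ 2 * (1 + t))
  | 7 => 2 * t * (1 + t) ^ 2 * (1 + t + t ^ 2) *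
      (s * (1 + t + 3 * t ^ 2 + t ^ 3) + t * (1 + 2 * t + 4 * t ^ 2 + 2 * t ^ 3))
  | _ => 0

/-- The constants `w_h`, where `q_h (x + w_h)` are the denominators in the complete quotients for
the second family, multiplied by `2 * (1 + t) ^ 3 * (1 + t + t ^ 2)`. -/
def secondRoot (t s : K) : ℕ → K
  | 2 => s * (t ^ 2 - t) - (1 + 4 * t + 7 * t ^ 2 + 5 * t ^ 3 + 3 * t ^ 4 + t ^ 5)
  | 3 => s * (2 + 3 * t + t ^ 2) + (1 + 2 * t + t ^ 2 - 3 * t ^ 3 - 3 * t ^ 4 - t ^ 5)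
  | 4 => s * (t + t ^ 2) - (1 + 2 * t + 3 * t ^ 2 + 3 * t ^ 3 + 3 * t ^ 4 + t ^ 5)
  | 5 => -s * (t + t ^ 2) - (1 + 4 * t + 7 * t ^ 2 + 7 * t ^ 3 + 3 * t ^ 4 + t ^ 5)
  | 6 => -s * (t + 3 * t ^ 2 + 2 * t ^ 3) -
      (1 + 4 * t + 9 * t ^ 2 + 11 * t ^ 3 + 7 * t ^ 4 + t ^ 5)
  | 7 => s * (2 + 5 * t + 7 * t ^ 2 + 4 * t ^ 3) +
      (1 + 4 * t + 9 * t ^ 2 + 11 * t ^ 3 + 7 * t ^ 4 + t ^ 5)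
  | _ => -(1 - (-4 + s) * t + (7 + s) * t ^ 2 + 9 * t ^ 3 + 5 * t ^ 4 + t ^ 5)

/-- The numerator of `u₂`. -/
def secondU (t s : K) : K :=
  -(1 + (8 - 6 * s) * t + (30 - 14 * s + s ^ 2) * t ^ 2 - 2 * (-39 + 11 * s + s ^ 2) * t ^ 3
      + (143 - 16 * s + s ^ 2) * t ^ 4 + 4 * (49 + s) * t ^ 5 + (199 + 12 * s) * t ^ 6
      + 2 * (70 + 3 * s) * t ^ 7 + 63 * t ^ 8 + 14 * t ^ 9 + t ^ 10)

/-- The numerator of `v₂`. -/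
def secondV (t s : K) : K :=
  -t ^ 3 * (1 + t) * (1 + t + 3 * t ^ 2 + t ^ 3) - s * t * (-1 - t - 2 * t ^ 2 + t ^ 4)

variable {t s : K}

theorem secondRoot_sq_add (h : s ^ 2 + t * s + s = t ^ 3 + t ^ 2)
    (k : ℕ) (hk : k < 7) (hk₀ : 0 < k) :
    secondRoot t s k ^ 2 + secondU t s = 2 * (secondShift t s k + secondShift t s (k + 1)) := by
  interval_cases k <;> simp only [secondRoot, secondShift, secondU]
  · ring
  · ring
  · linear_combination (4 + 12 * t + 12 * t ^ 2 + 8 * t ^ 3) * h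
  · linear_combination (4 * t ^ 3) * h
  · linear_combination (4 * t ^ 3) * h
  · linear_combination (8 * t ^ 3 + 12 * t ^ 4 + 12 * t ^ 5 + 4 * t ^ 6) * h

theorem secondRoot_sq_add_seven (h : s ^ 2 + t * s + s = t ^ 3 + t ^ 2) :
    secondRoot t s 7 ^ 2 + secondU t s = 2 * (secondShift t s 7 + secondShift t s 7) := by
  simp only [secondRoot, secondShift, secondU]
  linear_combination (4 + 20 * t + 52 * t ^ 2 + 88 * t ^ 3 + 88 * t ^ 4 + 56 * t ^ 5
    + 16 * t ^ 6) * h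

theorem secondShift_mul (h : s ^ 2 + t * s + s = t ^ 3 + t ^ 2)
    (k : ℕ) (hk : k < 8) (hk₁ : 1 < k) :
    secondShift t s k * (secondRoot t s (k - 1) + secondRoot t s k) =
      -4 * secondV t s * (1 + t) ^ 3 * (1 + t + t ^ 2) ^ 2 := by
  interval_cases k <;> simp only [secondRoot, secondShift, secondV]
  · ring
  · linear_combination (4 * t + 16 * t ^ 2 + 28 * t ^ 3 + 24 * t ^ 4 - 24 * t ^ 6 - 28 * t ^ 7
      - 16 * t ^ 8 - 4 * t ^ 9) * h
  · linear_combination (-4 * t ^ 2 - 20 * t ^ 3 - 48 * t ^ 4 - 72 * t ^ 5 - 72 * t ^ 6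
      - 48 * t ^ 7 - 20 * t ^ 8 - 4 * t ^ 9) * h
  · ring
  · linear_combination (-4 * t ^ 2 - 20 * t ^ 3 - 48 * t ^ 4 - 72 * t ^ 5 - 72 * t ^ 6
      - 48 * t ^ 7 - 20 * t ^ 8 - 4 * t ^ 9) * h
  · linear_combination (4 * t + 24 * t ^ 2 + 80 * t ^ 3 + 184 * t ^ 4 + 308 * t ^ 5 + 384 * t ^ 6
      + 356 * t ^ 7 + 240 * t ^ 8 + 112 * t ^ 9 + 32 * t ^ 10 + 4 * t ^ 11) * h

/-- The cofactor `b` is the conjugate of `secondV t s` under `s ↦ -1 - t - s`, which swaps the two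
roots of the curve equation. The product is the norm, a polynomial in `t` alone whose factors are
nonzero by hypothesis. -/
theorem secondV_ne_zero (h : s ^ 2 + t * s + s = t ^ 3 + t ^ 2) (ht : t ≠ 0)
    (ht₁ : 1 + t ≠ 0) (ht₂ : 1 + t + t ^ 2 ≠ 0)
    (ht₃ : t ^ 4 + 3 * t ^ 3 + 4 * t ^ 2 + 2 * t + 1 ≠ 0) :
    secondV t s ≠ 0 := by
  refine left_ne_zero_of_mul (b := -t - 2 * t ^ 2 - 4 * t ^ 3 - 4 * t ^ 4 - 3 * t ^ 5 - 3 * t ^ 6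
    - t ^ 7 + s * (-t - t ^ 2 - 2 * t ^ 3 + t ^ 5)) ?_
  have hprod : t ^ 5 * (1 + t) * (1 + t + t ^ 2) ^ 2 *
      (t ^ 4 + 3 * t ^ 3 + 4 * t ^ 2 + 2 * t + 1) ≠ 0 := by
    simp only [mul_ne_zero_iff, pow_ne_zero_iff, ne_eq, OfNat.ofNat_ne_zero, not_false_eq_true]
    exact ⟨⟨⟨ht, ht₁⟩, ht₂⟩, ht₃⟩
  convert hprod using 1
  rw [secondV]
  linear_combination (-t ^ 2 - 2 * t ^ 3 - 5 * t ^ 4 - 4 * t ^ 5 - 2 * t ^ 6 + 2 * t ^ 7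
    + 4 * t ^ 8 - t ^ 10) * h

theorem secondShift_ne_zero [CharZero K] (h : s ^ 2 + t * s + s = t ^ 3 + t ^ 2)
    (ht : t ≠ 0)
    (ht₁ : 1 + t ≠ 0) (ht₂ : 1 + t + t ^ 2 ≠ 0)
    (ht₃ : t ^ 4 + 3 * t ^ 3 + 4 * t ^ 2 + 2 * t + 1 ≠ 0)
    (k : ℕ) (hk : k < 8) (hk₁ : 1 < k) :
    secondShift t s k ≠ 0 := by
  have hV := secondV_ne_zero h ht ht₁ ht₂ ht₃
  rw [secondV] at hV
  have h2 : (2 : K) ≠ 0 := two_ne_zero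
  -- The factors below are handled by the same norm argument, each cofactor being the conjugate up
  -- to sign.
  have h3 : s * (1 - t) - t ^ 2 * (2 + t) ≠ 0 := by
    refine left_ne_zero_of_mul (b := -1 - t ^ 2 - t ^ 3 + s * (-1 + t)) ?_
    have hprod := mul_ne_zero (pow_ne_zero 2 ht) (pow_ne_zero 2 ht₂)
    convert hprod using 1
    linear_combination (-1 + 2 * t - t ^ 2) * h
  have h4 : s * t + (1 + 2 * t + 3 * t ^ 2 + t ^ 3) ≠ 0 := by
    refine left_ne_zero_of_mul (b := 1 + t + 2 * t ^ 2 + t ^ 3 - s * t) ?_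
    have hprod := mul_ne_zero ht₂ ht₃
    convert hprod using 1
    linear_combination (-t ^ 2) * h
  have h6 : s - t ^ 2 * (1 + t) ≠ 0 := by
    refine left_ne_zero_of_mul (b := -1 - t - t ^ 2 - t ^ 3 - s) ?_
    have hprod := mul_ne_zero (mul_ne_zero (pow_ne_zero 3 ht) ht₁) ht₂
    convert hprod using 1
    linear_combination -h
  have h7 : s * (1 + t + 3 * t ^ 2 + t ^ 3) + t * (1 + 2 * t + 4 * t ^ 2 + 2 * t ^ 3) ≠ 0 := by
    refine left_ne_zero_of_mul (b := 1 + t + 2 * t ^ 2 - t ^ 4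
      + s * (1 + t + 3 * t ^ 2 + t ^ 3)) ?_
    have hprod := mul_ne_zero (mul_ne_zero ht (pow_ne_zero 2 ht₂)) ht₃
    convert hprod using 1
    linear_combination (1 + 2 * t + 7 * t ^ 2 + 8 * t ^ 3 + 11 * t ^ 4 + 6 * t ^ 5 + t ^ 6) * h
  interval_cases k <;> simp only [secondShift] <;>
    simp only [mul_ne_zero_iff, pow_ne_zero_iff, neg_ne_zero, ne_eq, OfNat.ofNat_ne_zero,
      not_false_eq_true] <;>
    tauto

end SecondFamily

theorem sqrtHasCFPeriod_second {K : Type*} [Field K] [CharZero K] {t s : K}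
    (h : s ^ 2 + t * s + s = t ^ 3 + t ^ 2) (ht : t ≠ 0) (ht₁ : 1 + t ≠ 0)
    (ht₂ : 1 + t + t ^ 2 ≠ 0) (ht₃ : t ^ 4 + 3 * t ^ 3 + 4 * t ^ 2 + 2 * t + 1 ≠ 0) :
    SqrtHasCFPeriod (quartic (u₂ t s) (v₂ t s) (w₂ t s)) 14 := by
  have hu : u₂ t s = secondU t s / (4 * (1 + t) ^ 6 * (1 + t + t ^ 2) ^ 2) := by
    rw [u₂, secondU]
    ring
  have hv : v₂ t s = secondV t s / ((1 + t) ^ 6 * (1 + t + t ^ 2)) := rfl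
  have hw : w₂ t s = secondRoot t s 1 / (2 * (1 + t) ^ 3 * (1 + t + t ^ 2)) := by
    rw [w₂, secondRoot, neg_div]
    all_goals simp
  -- With `D = (1 + t) ^ 3 * (1 + t + t ^ 2)`, the numerators stand for `d D²`, `2 w D` and `4 u
  -- D²`; this restores the denominators.
  have scale {d d' w : K} (hd : w ^ 2 + secondU t s = 2 * (d + d')) :
      d / ((1 + t) ^ 6 * (1 + t + t ^ 2) ^ 2) + d' / ((1 + t) ^ 6 * (1 + t + t ^ 2) ^ 2) =
        2 * (w / (2 * (1 + t) ^ 3 * (1 + t + t ^ 2))) ^ 2 + 2 * u₂ t s := by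
    rw [hu]
    generalize 1 + t + t ^ 2 = b at *
    generalize 1 + t = a at *
    field_simp
    linear_combination -4 * hd
  rw [hw]
  refine quartic_hasCFPeriod_of_linear (m := 7)
    (d := fun k ↦ secondShift t s k / ((1 + t) ^ 6 * (1 + t + t ^ 2) ^ 2))
    (w := fun k ↦ secondRoot t s k / (2 * (1 + t) ^ 3 * (1 + t + t ^ 2)))
    (by norm_num) ?_ (by simp [secondShift]) (fun k hk hk₁ ↦ ?_) (fun k hk hk₀ ↦ ?_)
    (fun k hk hk₁ ↦ ?_) (scale (secondRoot_sq_add_seven h))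
  · rw [hv]
    exact div_ne_zero (secondV_ne_zero h ht ht₁ ht₂ ht₃)
      (mul_ne_zero (pow_ne_zero 6 ht₁) ht₂)
  · exact div_ne_zero (secondShift_ne_zero h ht ht₁ ht₂ ht₃ k hk hk₁)
      (mul_ne_zero (pow_ne_zero 6 ht₁) (pow_ne_zero 2 ht₂))
  · exact scale (secondRoot_sq_add h k hk hk₀)
  · have h1 := secondShift_mul h k hk hk₁
    rw [hv]
    generalize 1 + t + t ^ 2 = b at *
    generalize 1 + t = a at *
    field_simp
    linear_combination h1

end

end PeriodicCF

theorem mainTheorem8 {K : Type*} [Field K] [NumberField K] (hK : Module.finrank ℚ K = 2) :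
    (∀ t : K, t * (t - 1) * (2 * t - 1) ≠ 0 →
      PeriodicCF.SqrtHasCFPeriod
        (PeriodicCF.quartic (PeriodicCF.u₁ t) (PeriodicCF.v₁ t) (PeriodicCF.w₁ t)) 14) ∧
    (∀ t s : K, s ^ 2 + t * s + s = t ^ 3 + t ^ 2 →
      t * (t + 1) * (t ^ 2 + t + 1) * (t ^ 4 + 3 * t ^ 3 + 4 * t ^ 2 + 2 * t + 1) *
        (t ^ 4 - 7 * t ^ 3 - 6 * t ^ 2 + 2 * t + 1) ≠ 0 →
      PeriodicCF.SqrtHasCFPeriod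
        (PeriodicCF.quartic (PeriodicCF.u₂ t s) (PeriodicCF.v₂ t s) (PeriodicCF.w₂ t s)) 14) := by
  refine ⟨fun t ht ↦ PeriodicCF.sqrtHasCFPeriod_first ht (PeriodicCF.cubic_ne_zero hK t),
    fun t s h hts ↦ ?_⟩
  obtain ⟨⟨⟨⟨ht, ht₁⟩, ht₂⟩, ht₃⟩, -⟩ := by simpa only [mul_ne_zero_iff] using hts
  exact PeriodicCF.sqrtHasCFPeriod_second h ht (by rwa [add_comm])
    (by rwa [add_comm 1 t, add_comm, ← add_assoc]) ht₃
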